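/- Let $r:[t_-,t_+]\to\mathbb R$, $t_-<t_+$, be continuous, and smooth and positive on $(t_-,t_+)$, such that the rotationally symmetric region $\bar M=\{x\in\mathbb R^3: t_-\le x^3\le t_+,\ \sqrt{(x^1)^2+(x^2)^2}\le r(x^3)\}$ is convex. Put $S=\partial\bar M\cap\{t_-<x^3<t_+\}$ and $P_\pm=\{x^3=t_\pm\}$. Let $\bar X$ be the outward Euclidean unit normal of $S$, let $\bar\gamma\in[0,\pi]$ be the angle function on $S$ with $\cos\bar\gamma=\langle\bar X,\partial/\partial x^3\rangle_\delta$, and let $\bar\sigma$ and $\bar H$ be the induced metric and the mean curvature of $S$ with respect to the flat metric $\delta$ (mean curvatures are traces of the second fundamental form for the outward normal, positive on round spheres). Let $(M,g)$ be a smooth Riemannian 3-manifold with boundary, and let $\Psi:\bar M\cap U\to M$ be a smooth injective map with everywhere invertible differential, where $U\subset\{t_-<x^3<t_+\}$ is an open set containing $S$, such that $\Psi(x)\in\partial M$ exactly when $x\in S$. Identify $S$ with $\Psi(S)\subset\partial M$ and $g$ near $\Psi(S)$ with its pullback by $\Psi$. Let $\sigma$ be the metric induced by $g$ on $S$, and let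 $H_{\partial M}$ be the mean curvature of $S$ with respect to $g$ and the $g$-unit normal pointing out of $M$. Assume that $\sigma\ge\bar\sigma$ and $H_{\partial M}\ge\bar H$ on $S$. Let $\partial\Sigma\subset S$ be a closed regular $C^1$ curve which separates $\partial\bar M\cap P_+$ from $\partial\bar M\cap P_-$ in $\partial\bar M$, that is, no connected component of $\partial\bar M\setminus\partial\Sigma$ meets both. Let $\eta$ be a continuous field along $\partial\Sigma$ of vectors that are tangent to $S$, of $\sigma$-length $1$, and $\sigma$-orthogonal to $\partial\Sigma$ (either choice of side is allowed, in particular the normal pointing away from the $P_+$ side). Then, with $\mathrm d\lambda$ the line element of $g$, $$\int_{\partial\Sigma}\left(\frac{H_{\partial M}}{\sin\bar\gamma}-\frac1{\sin\bar\gamma}\frac{\partial\bar\gamma}{\partial\eta}\right)\mathrm d\lambda\ \ge\ 2\pi .$$ -/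

import Mathlib

open Set Filter Topology
open scoped Manifold ContDiff

noncomputable section

/-- Euclidean three-space; the coordinates `x¹, x², x³` are `x 0, x 1, x 2`. -/
abbrev E3 : Type := EuclideanSpace ℝ (Fin 3)

/-- The standard basis vectors of `ℝ³`. -/
def stdVec (i : Fin 3) : E3 := EuclideanSpace.single i (1 : ℝ)

/-- Distance to the `x³`-axis. -/
def axisDist (x : E3) : ℝ := √(x 0 ^ 2 + x 1 ^ 2)

/-- The profile of a region of `ℝ³` that is rotationally symmetric about the `x³`-axis and lies
between the planes `x³ = tm` and `x³ = tp`: the slice at height `s` is the disk of radius `r s`.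
At the two ends `r` may be positive (a disk) or zero with any kind of tip. -/
structure RotProfile where
  tm : ℝ
  tp : ℝ
  tm_lt_tp : tm < tp
  r : ℝ → ℝ
  r_cont : ContinuousOn r (Icc tm tp)
  r_smooth : ContDiffOn ℝ ∞ r (Ioo tm tp)
  r_pos : ∀ s ∈ Ioo tm tp, 0 < r s

namespace RotProfile

variable (B : RotProfile)

/-- The reference region. -/
def body : Set E3 := {x | x 2 ∈ Icc B.tm B.tp ∧ axisDist x ≤ B.r (x 2)}

/-- The boundary surface of the reference region. -/
def bdry : Set E3 := frontier B.body

/-- The north polar set: the boundary points in the plane `x³ = tp`. -/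
def northCap : Set E3 := B.bdry ∩ {x | x 2 = B.tp}

/-- The south polar set: the boundary points in the plane `x³ = tm`. -/
def southCap : Set E3 := B.bdry ∩ {x | x 2 = B.tm}

/-- The part of the boundary strictly between the two planes. -/
def lateral : Set E3 := B.bdry ∩ {x | x 2 ∈ Ioo B.tm B.tp}

/-- Weak convexity: the surface bounds a convex region. -/
def WeaklyConvex : Prop := Convex ℝ B.body

/-- The Euclidean unit normal pointing out of the region, at points of the lateral surface
`axisDist x = r (x³)`. The formula also extends it to nearby points: it is the normalized gradient
of `axisDist x - r (x³)`, that is, the unit normal of the level sets of this function. -/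
def outNormal (x : E3) : E3 :=
  (√(1 + deriv B.r (x 2) ^ 2))⁻¹ •
    !₂[x 0 / axisDist x, x 1 / axisDist x, - deriv B.r (x 2)]

/-- The contact angle `γ̄ ∈ [0, π]` of the horizontal planes with the surface in the flat metric:
`cos γ̄ = ⟨X̄, ∂/∂x³⟩`. -/
def angle (x : E3) : ℝ := Real.arccos (inner ℝ (B.outNormal x) (stdVec 2))

/-- `v` is tangent to the lateral surface at its point `x`. -/
def IsTangent (x v : E3) : Prop := inner ℝ (B.outNormal x) v = 0

end RotProfile

/-- A field of `3 × 3` matrices on `ℝ³`, used for the components `g i j` of a metric. -/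
abbrev MetricField : Type := E3 → Matrix (Fin 3) (Fin 3) ℝ

/-- The flat metric. -/
def flatMetric : MetricField := fun _ => 1

/-- The bilinear form of a metric at a point. -/
def MetricField.form (G : MetricField) (x v w : E3) : ℝ := ∑ i, ∑ j, G x i j * v i * w j

/-- The length of a vector. -/
def MetricField.len (G : MetricField) (x v : E3) : ℝ := √(G.form x v v)

/-- The partial derivative in the `i`-th direction at a point of `D`, using values on `D` only. -/
def partialWithin (D : Set E3) (i : Fin 3) (f : E3 → ℝ) (x : E3) : ℝ :=
  fderivWithin ℝ f D x (stdVec i)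

/-- The Christoffel symbols `Γᵏᵢⱼ` of the metric `G` on `D`. -/
def christoffel (G : MetricField) (D : Set E3) (k i j : Fin 3) (x : E3) : ℝ :=
  (1 / 2) * ∑ l, (G x)⁻¹ k l *
    (partialWithin D i (fun y => G y j l) x + partialWithin D j (fun y => G y i l) x
      - partialWithin D l (fun y => G y i j) x)

/-- The unit normal for the metric `G` whose dual covector is a positive multiple of
`⟨n x, ·⟩` (Euclidean product): raise the index with `G⁻¹` and normalize. If `n` is the outward
Euclidean normal of a region, this is the outward `G`-unit normal. -/
def unitNormal (G : MetricField) (n : E3 → E3) (k : Fin 3) (x : E3) : ℝ :=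
  (∑ l, (G x)⁻¹ k l * n x l) / √(∑ a, ∑ b, (G x)⁻¹ a b * n x a * n x b)

/-- The covariant derivative `(∇ᵢ X)ᵏ = ∂ᵢ Xᵏ + Γᵏᵢⱼ Xʲ` of a vector field. -/
def covDeriv (G : MetricField) (D : Set E3) (X : Fin 3 → E3 → ℝ) (i k : Fin 3) (x : E3) : ℝ :=
  partialWithin D i (X k) x + ∑ j, christoffel G D k i j x * X j x

/-- The mean curvature, with respect to `G`, of the hypersurface with Euclidean normal field `n`:
the trace of the second fundamental form `A(v, w) = ⟨∇ᵥ X, w⟩`, with `X` the `G`-unit normal. As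
`X` is a unit field near the surface, `∇X` has no component along `X`, so its trace over the tangent
plane of the surface equals its full trace. It is positive for round balls and outward normals. -/
def meanCurvature (G : MetricField) (D : Set E3) (n : E3 → E3) (x : E3) : ℝ :=
  ∑ i, covDeriv G D (unitNormal G n) i i x

/-- The identification of a one-sided neighbourhood of the lateral surface in the reference region
with a neighbourhood of part of `∂M` in `M`, matching the surface with `∂M`. -/
structure BoundaryIdentification (B : RotProfile) (M : Type*) [TopologicalSpace M]
    [ChartedSpace (EuclideanHalfSpace 3) M] where
  U : Set E3
  isOpen_U : IsOpen U
  lateral_subset : B.lateral ⊆ U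
  U_subset : U ⊆ {x | x 2 ∈ Ioo B.tm B.tp}
  toFun : E3 → M
  smooth : ContMDiffOn 𝓘(ℝ, E3) (𝓡∂ 3) ∞ toFun (B.body ∩ U)
  injOn : InjOn toFun (B.body ∩ U)
  bijective_deriv : ∀ x ∈ B.body ∩ U,
    Function.Bijective (mfderivWithin 𝓘(ℝ, E3) (𝓡∂ 3) toFun (B.body ∩ U) x)
  boundary_iff : ∀ x ∈ B.body ∩ U, (𝓡∂ 3).IsBoundaryPoint (toFun x) ↔ x ∈ B.lateral

namespace BoundaryIdentification

variable {B : RotProfile} {M : Type*} [TopologicalSpace M]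
  [ChartedSpace (EuclideanHalfSpace 3) M]

/-- The domain of the identification, a one-sided neighbourhood of the lateral surface. -/
def dom (Ψ : BoundaryIdentification B M) : Set E3 := B.body ∩ Ψ.U

/-- The Riemannian metric of `M` in the identification: `g i j = g (dΨ eᵢ, dΨ eⱼ)`. -/
def metric [IsManifold (𝓡∂ 3) ∞ M] (Ψ : BoundaryIdentification B M)
    (g : Bundle.ContMDiffRiemannianMetric (𝓡∂ 3) ∞ (EuclideanSpace ℝ (Fin 3))
      (fun p : M => TangentSpace (𝓡∂ 3) p)) : MetricField :=
  fun x => Matrix.of fun i j => g.inner (Ψ.toFun x)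
    (mfderivWithin 𝓘(ℝ, E3) (𝓡∂ 3) Ψ.toFun Ψ.dom x (stdVec i))
    (mfderivWithin 𝓘(ℝ, E3) (𝓡∂ 3) Ψ.toFun Ψ.dom x (stdVec j))

end BoundaryIdentification

/-- `c` is a `T`-periodic regular parametrization of a closed `C¹` curve in the lateral surface that
separates the two polar sets in the boundary surface: no connected component of the complement of
the curve meets both. -/
structure IsSeparatingCurve (B : RotProfile) (c : ℝ → E3) (T : ℝ) : Prop where
  period_pos : 0 < T
  periodic : Function.Periodic c T
  contDiff : ContDiff ℝ 1 c
  regular : ∀ t, deriv c t ≠ 0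
  mem_lateral : ∀ t, c t ∈ B.lateral
  separates : ∀ x ∈ B.northCap, ∀ y ∈ B.southCap,
    y ∉ connectedComponentIn (B.bdry \ range c) x

/-- `η` is a continuous field of `G`-unit normals of the curve `c` in the lateral surface. -/
structure IsUnitConormal (B : RotProfile) (G : MetricField) (c η : ℝ → E3) : Prop where
  continuous : Continuous η
  tangent : ∀ t, B.IsTangent (c t) (η t)
  orthogonal : ∀ t, G.form (c t) (η t) (deriv c t) = 0
  unit : ∀ t, G.form (c t) (η t) (η t) = 1

end

/-!
For a surface of revolution with profile `r`, write `w = √(1 + r'²)`. The contact angle is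
`γ̄ = π / 2 + arctan r'` (`RotProfile.angle_eq`), so `sin γ̄ = 1 / w` and `dγ̄ = r'' / w² dx³`,
while the flat mean curvature is `H̄ = 1 / (r w) - r'' / w³`
(`RotProfile.meanCurvature_flatMetric`). Hence `H ≥ H̄` bounds the integrand from below by

  `(1 / r + (-r'') / w² * (1 + w η³)) |c'|_g`.

Convexity of the body gives `r'' ≤ 0` (`RotProfile.deriv_deriv_r_nonpos`). A vector tangent to the
surface has `|w η³| ≤ |η|_δ`, and `|η|_δ ≤ |η|_σ = 1` as `σ ≥ σ̄`, so the second term is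
nonnegative, whichever side `η` points to. The first term is at least `|c'|_δ / r`, hence at least the angular
speed of `c` about the axis (`RotProfile.abs_angular_le_integrand`).

A separating curve meets every meridian, as a meridian is a connected set joining the two polar
sets (`IsSeparatingCurve.exists_mem_meridian`). Therefore its polar angle takes every value modulo
`2π`, and its total variation over a period is at least `2π`
(`IsSeparatingCurve.two_pi_le_integral`).

The comparison of integrals needs the integrand to be integrable. It is in fact continuous
(`continuous_integrand`): the components of the metric are smooth up to the boundary of the
reference region, which has unique derivatives because it is convex with nonempty interior.
-/

/-! ### The reference region, its profile and its contact angle -/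

theorem continuous_axisDist : Continuous axisDist := by
  unfold axisDist; fun_prop

theorem axisDist_nonneg (x : E3) : 0 ≤ axisDist x := Real.sqrt_nonneg _

theorem axisDist_sq (x : E3) : axisDist x ^ 2 = x 0 ^ 2 + x 1 ^ 2 :=
  Real.sq_sqrt (by positivity)

/-- The distance to the axis is smooth off the axis. -/
theorem contDiffAt_axisDist {x : E3} (hx : 0 < axisDist x) : ContDiffAt ℝ ∞ axisDist x := by
  have h : x 0 ^ 2 + x 1 ^ 2 ≠ 0 := by rw [← axisDist_sq]; positivity
  unfold axisDist
  exact ContDiffAt.sqrt (by fun_prop) h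

namespace RotProfile

variable (B : RotProfile)

theorem isOpen_strictBody : IsOpen {x : E3 | x 2 ∈ Ioo B.tm B.tp ∧ axisDist x < B.r (x 2)} := by
  have h1 : IsOpen {x : E3 | x 2 ∈ Ioo B.tm B.tp} :=
    isOpen_Ioo.preimage (by fun_prop : Continuous fun x : E3 => x 2)
  have h2 : ContinuousOn (fun x : E3 => B.r (x 2) - axisDist x) {x : E3 | x 2 ∈ Ioo B.tm B.tp} :=
    ((B.r_cont.mono Ioo_subset_Icc_self).comp (f := fun x : E3 => x 2) (by fun_prop)
      (fun x hx => hx)).sub continuous_axisDist.continuousOn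
  convert h2.isOpen_inter_preimage h1 (isOpen_Ioi (a := 0)) using 1
  ext x; simp

theorem strictBody_subset_interior :
    {x : E3 | x 2 ∈ Ioo B.tm B.tp ∧ axisDist x < B.r (x 2)} ⊆ interior B.body :=
  interior_maximal (fun _ hx => ⟨Ioo_subset_Icc_self hx.1, hx.2.le⟩) B.isOpen_strictBody

theorem isClosed_body : IsClosed B.body := by
  have h1 : IsClosed {x : E3 | x 2 ∈ Icc B.tm B.tp} :=
    isClosed_Icc.preimage (by fun_prop : Continuous fun x : E3 => x 2)
  have h2 : ContinuousOn (fun x : E3 => B.r (x 2) - axisDist x) {x : E3 | x 2 ∈ Icc B.tm B.tp} :=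
    (B.r_cont.comp (f := fun x : E3 => x 2) (by fun_prop) (fun x hx => hx)).sub
      continuous_axisDist.continuousOn
  convert h2.preimage_isClosed_of_isClosed h1 (isClosed_Ici (a := 0)) using 1
  ext x; simp [body]

/-- The interior of the body is not empty, as its axis passes through it. -/
theorem nonempty_interior_body : (interior B.body).Nonempty := by
  obtain ⟨s, hs⟩ := nonempty_Ioo.2 B.tm_lt_tp
  refine ⟨!₂[0, 0, s], B.strictBody_subset_interior ⟨by simpa using hs, ?_⟩⟩
  simpa [axisDist] using B.r_pos s hs

/-- The point at height `s` of the meridian of the boundary surface at the angle `φ`. -/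
noncomputable def meridian (φ s : ℝ) : E3 := !₂[B.r s * Real.cos φ, B.r s * Real.sin φ, s]

variable {B}

theorem body_of_mem_lateral {x : E3} (hx : x ∈ B.lateral) : x ∈ B.body :=
  B.isClosed_body.frontier_subset hx.1

theorem axisDist_of_mem_lateral {x : E3} (hx : x ∈ B.lateral) : axisDist x = B.r (x 2) := by
  refine le_antisymm (body_of_mem_lateral hx).2 (not_lt.1 fun h => ?_)
  have := B.strictBody_subset_interior ⟨hx.2, h⟩
  exact hx.1.2 this

theorem axisDist_pos_of_mem_lateral {x : E3} (hx : x ∈ B.lateral) : 0 < axisDist x := by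
  rw [axisDist_of_mem_lateral hx]; exact B.r_pos _ hx.2

theorem r_nonneg {s : ℝ} (hs : s ∈ Icc B.tm B.tp) : 0 ≤ B.r s := by
  rw [← closure_Ioo B.tm_lt_tp.ne] at hs
  exact closure_minimal (s := Ioo B.tm B.tp) (t := Icc B.tm B.tp ∩ B.r ⁻¹' Ici 0)
    (fun t ht => ⟨Ioo_subset_Icc_self ht, (B.r_pos t ht).le⟩)
    (B.r_cont.preimage_isClosed_of_isClosed isClosed_Icc isClosed_Ici) hs |>.2

theorem continuousOn_meridian (φ : ℝ) : ContinuousOn (B.meridian φ) (Icc B.tm B.tp) := by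
  have h := B.r_cont
  refine (PiLp.continuous_toLp 2 _).comp_continuousOn (continuousOn_pi.2 fun i => ?_)
  fin_cases i
  · exact h.mul continuousOn_const
  · exact h.mul continuousOn_const
  · exact continuousOn_id

theorem axisDist_polar {ρ : ℝ} (hρ : 0 ≤ ρ) (φ s : ℝ) :
    axisDist !₂[ρ * Real.cos φ, ρ * Real.sin φ, s] = ρ := by
  have : (ρ * Real.cos φ) ^ 2 + (ρ * Real.sin φ) ^ 2 = ρ ^ 2 := by
    linear_combination ρ ^ 2 * Real.cos_sq_add_sin_sq φ
  simp [axisDist, this, Real.sqrt_sq hρ]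

theorem meridian_mem_bdry (φ : ℝ) {s : ℝ} (hs : s ∈ Icc B.tm B.tp) :
    B.meridian φ s ∈ B.bdry := by
  have h0 := r_nonneg hs
  refine ⟨subset_closure ⟨by simpa [meridian] using hs, ?_⟩, fun hint => ?_⟩
  · rw [meridian, axisDist_polar h0]; simp
  -- Pushing the point radially outwards leaves the body at once.
  have hc : Continuous fun ρ : ℝ => (!₂[ρ * Real.cos φ, ρ * Real.sin φ, s] : E3) := by
    refine (PiLp.continuous_toLp 2 _).comp (continuous_pi fun i => ?_)
    fin_cases i <;> simp <;> fun_prop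
  have hev : ∀ᶠ ρ in 𝓝[>] (B.r s),
      (!₂[ρ * Real.cos φ, ρ * Real.sin φ, s] : E3) ∈ interior B.body :=
    (hc.continuousAt.eventually (isOpen_interior.mem_nhds hint)).filter_mono nhdsWithin_le_nhds
  obtain ⟨ρ, hρ, hρ'⟩ := (hev.and self_mem_nhdsWithin).exists
  have h := (interior_subset hρ).2
  have hρ'' : B.r s < ρ := hρ'
  rw [axisDist_polar (h0.trans hρ''.le)] at h
  simp at h
  linarith

/-- Convexity of the body makes its profile concave. -/
theorem concaveOn_r (hB : B.WeaklyConvex) : ConcaveOn ℝ (Ioo B.tm B.tp) B.r := by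
  refine ⟨convex_Ioo _ _, fun s hs t ht a b ha hb hab => ?_⟩
  have hmem : ∀ s ∈ Ioo B.tm B.tp, B.meridian 0 s ∈ B.body := fun s hs =>
    B.isClosed_body.frontier_subset (meridian_mem_bdry 0 (Ioo_subset_Icc_self hs))
  have h := (hB (hmem s hs) (hmem t ht) ha hb hab).2
  have h0 : 0 ≤ a * B.r s + b * B.r t :=
    add_nonneg (mul_nonneg ha (B.r_pos s hs).le) (mul_nonneg hb (B.r_pos t ht).le)
  simpa [meridian, axisDist, Real.sqrt_sq h0] using h

theorem contDiffOn_deriv_r : ContDiffOn ℝ ∞ (deriv B.r) (Ioo B.tm B.tp) :=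
  B.r_smooth.deriv_of_isOpen isOpen_Ioo (by simp)

theorem deriv_deriv_r_nonpos (hB : B.WeaklyConvex) {s : ℝ} (hs : s ∈ Ioo B.tm B.tp) :
    deriv (deriv B.r) s ≤ 0 := by
  have h := (concaveOn_r hB).antitoneOn_deriv fun x hx =>
    (B.r_smooth.differentiableOn (by simp)).differentiableAt (isOpen_Ioo.mem_nhds hx)
  have := h.derivWithin_nonpos (x := s)
  rwa [derivWithin_of_isOpen isOpen_Ioo hs] at this

theorem inner_outNormal_stdVec (x : E3) :
    inner ℝ (B.outNormal x) (stdVec 2) =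
      -(deriv B.r (x 2) / √(1 + deriv B.r (x 2) ^ 2)) := by
  simp [outNormal, stdVec, EuclideanSpace.inner_single_right]
  ring

theorem angle_eq (x : E3) : B.angle x = Real.pi / 2 + Real.arctan (deriv B.r (x 2)) := by
  rw [angle, inner_outNormal_stdVec, Real.arccos_eq_pi_div_two_sub_arcsin, Real.arcsin_neg,
    Real.arctan_eq_arcsin]
  ring

theorem sin_angle (x : E3) : Real.sin (B.angle x) = 1 / √(1 + deriv B.r (x 2) ^ 2) := by
  rw [angle_eq, add_comm, Real.sin_add_pi_div_two, Real.cos_arctan]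

theorem hasFDerivAt_angle {x : E3} (hx : x 2 ∈ Ioo B.tm B.tp) :
    HasFDerivAt B.angle ((deriv (deriv B.r) (x 2) / (1 + deriv B.r (x 2) ^ 2)) •
      (EuclideanSpace.proj 2 : E3 →L[ℝ] ℝ)) x := by
  have h1 : HasDerivAt (deriv B.r) (deriv (deriv B.r) (x 2)) (x 2) :=
    ((contDiffOn_deriv_r.differentiableOn (by simp)).differentiableAt
      (isOpen_Ioo.mem_nhds hx)).hasDerivAt
  have hp : HasFDerivAt (fun y : E3 => y 2) (EuclideanSpace.proj 2 : E3 →L[ℝ] ℝ) x :=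
    (EuclideanSpace.proj 2 : E3 →L[ℝ] ℝ).hasFDerivAt
  have h2 := HasDerivAt.comp_hasFDerivAt x (f := fun y : E3 => y 2)
    (h1.arctan.const_add (Real.pi / 2)) hp
  have h3 : B.angle = fun x => Real.pi / 2 + Real.arctan (deriv B.r (x 2)) := funext angle_eq
  rw [h3]
  rwa [one_div_mul_eq_div] at h2

theorem fderiv_angle {x : E3} (hx : x 2 ∈ Ioo B.tm B.tp) (v : E3) :
    fderiv ℝ B.angle x v = deriv (deriv B.r) (x 2) / (1 + deriv B.r (x 2) ^ 2) * v 2 := by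
  rw [(hasFDerivAt_angle hx).fderiv]; simp

/-- Tangency is the linearization of the equation `axisDist x = r (x³)` of the surface. -/
theorem isTangent_iff {x v : E3} : B.IsTangent x v ↔
    (x 0 * v 0 + x 1 * v 1) / axisDist x = deriv B.r (x 2) * v 2 := by
  have h : √(1 + deriv B.r (x 2) ^ 2) ≠ 0 := (Real.sqrt_pos.2 (by positivity)).ne'
  simp [IsTangent, outNormal, PiLp.inner_apply, Fin.sum_univ_three, inner_smul_left]
  constructor
  · intro h'
    have h'' := h'.resolve_left h
    rw [add_div]; linear_combination h''
  · intro h'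
    right
    rw [add_div] at h'; linear_combination h'

end RotProfile

/-! ### Smoothness of the pulled back metric and continuity of the mean curvature -/

theorem contDiffOn_matrix_det {ι : Type*} [Fintype ι] [DecidableEq ι] {A : E3 → Matrix ι ι ℝ}
    {D : Set E3} (hA : ∀ i j, ContDiffOn ℝ ∞ (fun x => A x i j) D) :
    ContDiffOn ℝ ∞ (fun x => (A x).det) D := by
  simp only [Matrix.det_apply]
  exact ContDiffOn.sum fun σ _ => (contDiffOn_prod fun i _ => hA _ _).const_smul _

namespace MetricField

theorem contDiffOn_inv {G : MetricField} {D : Set E3}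
    (hG : ∀ i j, ContDiffOn ℝ ∞ (fun x => G x i j) D) (hpos : ∀ x ∈ D, (G x).PosDef) (k l : Fin 3) :
    ContDiffOn ℝ ∞ (fun x => (G x)⁻¹ k l) D := by
  simp only [Matrix.inv_def, Ring.inverse_eq_inv', Matrix.smul_apply, smul_eq_mul,
    Matrix.adjugate_apply]
  refine ((contDiffOn_matrix_det hG).inv fun x hx => (hpos x hx).det_pos.ne').mul
    (contDiffOn_matrix_det fun i j => ?_)
  by_cases h : i = l
  · subst h; simpa using contDiffOn_const
  · simpa [Matrix.updateRow_ne h] using hG i j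

theorem continuousOn_partialWithin {D : Set E3} (hD : UniqueDiffOn ℝ D) {V : Set E3}
    (hV : IsOpen V) {f : E3 → ℝ} (hf : ContDiffOn ℝ ∞ f (D ∩ V)) (i : Fin 3) :
    ContinuousOn (partialWithin D i f) (D ∩ V) := by
  have h := (hf.continuousOn_fderivWithin (hD.inter hV) (by simp)).clm_apply
    (continuousOn_const (c := stdVec i))
  refine h.congr fun x hx => ?_
  simp only [partialWithin, fderivWithin_inter (hV.mem_nhds hx.2)]

theorem contDiffOn_unitNormal {G : MetricField} {D : Set E3} {n : E3 → E3}
    (hG : ∀ i j, ContDiffOn ℝ ∞ (fun x => G x i j) D) (hpos : ∀ x ∈ D, (G x).PosDef)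
    (hn : ∀ i, ContDiffOn ℝ ∞ (fun x => n x i) D) (hn0 : ∀ x ∈ D, n x ≠ 0) (k : Fin 3) :
    ContDiffOn ℝ ∞ (unitNormal G n k) D := by
  have hi := contDiffOn_inv hG hpos
  have hq : ContDiffOn ℝ ∞ (fun x => ∑ a, ∑ b, (G x)⁻¹ a b * n x a * n x b) D :=
    ContDiffOn.sum fun a _ => ContDiffOn.sum fun b _ => ((hi a b).mul (hn a)).mul (hn b)
  have hq0 : ∀ x ∈ D, 0 < ∑ a, ∑ b, (G x)⁻¹ a b * n x a * n x b := fun x hx => by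
    have hne : (fun i => n x i) ≠ 0 := fun h => hn0 x hx (by ext i; exact congrFun h i)
    have := (hpos x hx).inv.dotProduct_mulVec_pos hne
    simp only [dotProduct, Matrix.mulVec, Pi.star_apply, star_trivial, Finset.mul_sum] at this
    refine this.trans_eq (Finset.sum_congr rfl fun a _ => Finset.sum_congr rfl fun b _ => ?_)
    ring
  exact (ContDiffOn.sum fun l _ => (hi k l).mul (hn l)).div
    (hq.sqrt fun x hx => (hq0 x hx).ne') fun x hx => (Real.sqrt_pos.2 (hq0 x hx)).ne'

/-- The mean curvature of the level surfaces of a smooth normal field is continuous. -/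
theorem continuousOn_meanCurvature {G : MetricField} {D : Set E3} (hD : UniqueDiffOn ℝ D)
    {V : Set E3} (hV : IsOpen V) {n : E3 → E3}
    (hG : ∀ i j, ContDiffOn ℝ ∞ (fun x => G x i j) D) (hpos : ∀ x ∈ D, (G x).PosDef)
    (hn : ∀ i, ContDiffOn ℝ ∞ (fun x => n x i) (D ∩ V)) (hn0 : ∀ x ∈ D ∩ V, n x ≠ 0) :
    ContinuousOn (meanCurvature G D n) (D ∩ V) := by
  have hG' : ∀ i j, ContDiffOn ℝ ∞ (fun x => G x i j) (D ∩ V) := fun i j =>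
    (hG i j).mono inter_subset_left
  have hpos' : ∀ x ∈ D ∩ V, (G x).PosDef := fun x hx => hpos x hx.1
  have hN := contDiffOn_unitNormal hG' hpos' hn hn0
  have hΓ : ∀ k i j, ContinuousOn (christoffel G D k i j) (D ∩ V) := fun k i j =>
    continuousOn_const.mul <| continuousOn_finsetSum _ fun l _ =>
      (contDiffOn_inv hG' hpos' k l).continuousOn.mul
        (((continuousOn_partialWithin hD hV (hG' j l) i).add
          (continuousOn_partialWithin hD hV (hG' i l) j)).sub
          (continuousOn_partialWithin hD hV (hG' i j) l))
  exact continuousOn_finsetSum _ fun i _ => (continuousOn_partialWithin hD hV (hN i) i).add <|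
    continuousOn_finsetSum _ fun j _ => (hΓ i i j).mul (hN j).continuousOn

end MetricField

theorem RotProfile.contDiffOn_outNormal (B : RotProfile) (i : Fin 3) :
    ContDiffOn ℝ ∞ (fun x => B.outNormal x i)
      {x : E3 | x 2 ∈ Ioo B.tm B.tp ∧ 0 < axisDist x} := by
  have hd : ContDiffOn ℝ ∞ (fun x : E3 => deriv B.r (x 2))
      {x : E3 | x 2 ∈ Ioo B.tm B.tp ∧ 0 < axisDist x} :=
    contDiffOn_deriv_r.comp (f := fun x : E3 => x 2) (by fun_prop) fun x hx => hx.1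
  have hW := ((contDiffOn_const (c := (1 : ℝ))).add (hd.pow 2)).sqrt
    (fun x _ => (by positivity : (1 + deriv B.r (x 2) ^ 2 : ℝ) ≠ 0))
  have hW' := hW.inv fun x _ =>
    (Real.sqrt_pos.2 (by positivity : (0 : ℝ) < 1 + deriv B.r (x 2) ^ 2)).ne'
  have hρ : ContDiffOn ℝ ∞ axisDist {x : E3 | x 2 ∈ Ioo B.tm B.tp ∧ 0 < axisDist x} :=
    fun x hx => (contDiffAt_axisDist hx.2).contDiffWithinAt
  have hx : ∀ j : Fin 3, ContDiffOn ℝ ∞ (fun x : E3 => x j / axisDist x)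
      {x : E3 | x 2 ∈ Ioo B.tm B.tp ∧ 0 < axisDist x} := fun j =>
    (show ContDiff ℝ ∞ (fun x : E3 => x j) by fun_prop).contDiffOn.div hρ fun x hx => hx.2.ne'
  fin_cases i
  · exact hW'.mul (hx 0)
  · exact hW'.mul (hx 1)
  · exact hW'.mul hd.neg

theorem RotProfile.norm_sq_outNormal (B : RotProfile) {x : E3} (hx : 0 < axisDist x) :
    B.outNormal x 0 ^ 2 + B.outNormal x 1 ^ 2 + B.outNormal x 2 ^ 2 = 1 := by
  have h1 := axisDist_sq x
  have h2 : √(1 + deriv B.r (x 2) ^ 2) ^ 2 = _ := Real.sq_sqrt (by positivity)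
  have h3 : 0 < √(1 + deriv B.r (x 2) ^ 2) := Real.sqrt_pos.2 (by positivity)
  simp [outNormal]
  field_simp
  rw [h2]
  linear_combination - h1

/-- The pullback of a smooth Riemannian metric by a smooth map defined on a subset `D` of a vector
space, evaluated on two constant vector fields, is smooth. -/
theorem contDiffOn_inner_mfderivWithin {E : Type*} [NormedAddCommGroup E] [NormedSpace ℝ E]
    {F : Type*} [NormedAddCommGroup F] [NormedSpace ℝ F] {H : Type*} [TopologicalSpace H]
    {I : ModelWithCorners ℝ F H} {M : Type*} [TopologicalSpace M] [ChartedSpace H M]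
    [IsManifold I ∞ M]
    (g : Bundle.ContMDiffRiemannianMetric I ∞ F (fun p : M => TangentSpace I p))
    {f : E → M} {D : Set E} (hf : ContMDiffOn 𝓘(ℝ, E) I ∞ f D) (hD : UniqueDiffOn ℝ D) (v w : E) :
    ContDiffOn ℝ ∞ (fun x => g.inner (f x) (mfderivWithin 𝓘(ℝ, E) I f D x v)
      (mfderivWithin 𝓘(ℝ, E) I f D x w)) D := by
  have hT := hf.contMDiffOn_tangentMapWithin (m := ∞) (by simp) hD.uniqueMDiffOn
  have hv : ∀ v : E, ContMDiffOn 𝓘(ℝ, E) I.tangent ∞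
      (fun x => (⟨f x, mfderivWithin 𝓘(ℝ, E) I f D x v⟩ : TangentBundle I M)) D := fun v => by
    have hs : ContMDiff 𝓘(ℝ, E) 𝓘(ℝ, E).tangent ∞
        (fun x => (⟨x, v⟩ : TangentBundle 𝓘(ℝ, E) E)) :=
      contMDiff_vectorSpace_iff_contDiff.2 contDiff_const
    exact hT.comp hs.contMDiffOn fun x hx => hx
  have h : ContMDiffOn 𝓘(ℝ, E) (I.prod 𝓘(ℝ)) ∞
      (fun x => Bundle.TotalSpace.mk' ℝ (E := Bundle.Trivial M ℝ) (f x)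
        (g.inner (f x) (mfderivWithin 𝓘(ℝ, E) I f D x v)
          (mfderivWithin 𝓘(ℝ, E) I f D x w))) D := by
    apply ContMDiffOn.clm_bundle_apply₂ (F₁ := F) (F₂ := F)
    · exact g.contMDiff.comp_contMDiffOn hf
    · exact hv v
    · exact hv w
  intro x hx
  have := h x hx
  simp only [Bundle.contMDiffWithinAt_totalSpace] at this
  exact this.2.contDiffWithinAt

namespace BoundaryIdentification

variable {B : RotProfile} {M : Type*} [TopologicalSpace M]
  [ChartedSpace (EuclideanHalfSpace 3) M]

theorem uniqueDiffOn_dom (hB : B.WeaklyConvex) (Ψ : BoundaryIdentification B M) :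
    UniqueDiffOn ℝ Ψ.dom :=
  (uniqueDiffOn_convex hB B.nonempty_interior_body).inter Ψ.isOpen_U

variable [IsManifold (𝓡∂ 3) ∞ M]

theorem contDiffOn_metric (hB : B.WeaklyConvex) (Ψ : BoundaryIdentification B M)
    (g : Bundle.ContMDiffRiemannianMetric (𝓡∂ 3) ∞ (EuclideanSpace ℝ (Fin 3))
      (fun p : M => TangentSpace (𝓡∂ 3) p)) (i j : Fin 3) :
    ContDiffOn ℝ ∞ (fun x => Ψ.metric g x i j) Ψ.dom := by
  exact contDiffOn_inner_mfderivWithin g Ψ.smooth (Ψ.uniqueDiffOn_dom hB) _ _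

theorem form_metric (Ψ : BoundaryIdentification B M)
    (g : Bundle.ContMDiffRiemannianMetric (𝓡∂ 3) ∞ (EuclideanSpace ℝ (Fin 3))
      (fun p : M => TangentSpace (𝓡∂ 3) p)) (x v : E3) :
    (Ψ.metric g).form x v v = g.inner (Ψ.toFun x)
      (mfderivWithin 𝓘(ℝ, E3) (𝓡∂ 3) Ψ.toFun Ψ.dom x v)
      (mfderivWithin 𝓘(ℝ, E3) (𝓡∂ 3) Ψ.toFun Ψ.dom x v) := by
  have hv : v = ∑ i, v i • stdVec i := by
    ext j
    simp [stdVec, Pi.single_apply]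
  -- The linear map is kept abstract here, so that its domain is `E3` and not a tangent space of it.
  have h : ∀ (L : E3 →L[ℝ] TangentSpace (𝓡∂ 3) (Ψ.toFun x)) (v : E3),
      v = ∑ i, v i • stdVec i → g.inner (Ψ.toFun x) (L v) (L v) =
        ∑ i, ∑ j, g.inner (Ψ.toFun x) (L (stdVec i)) (L (stdVec j)) * v i * v j := by
    intro L v hv
    have hL : L v = ∑ i, v i • L (stdVec i) := by
      conv_lhs => rw [hv]
      rw [map_sum]
      exact Finset.sum_congr rfl fun i _ => map_smul L _ _
    rw [hL, map_sum, Finset.sum_comm]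
    refine Finset.sum_congr rfl fun j _ => ?_
    rw [map_smul, map_sum, sum_apply, smul_eq_mul, Finset.mul_sum]
    refine Finset.sum_congr rfl fun i _ => ?_
    rw [map_smul]
    simp only [smul_apply, smul_eq_mul]
    ring
  exact (h _ v hv).symm

theorem form_metric_pos (Ψ : BoundaryIdentification B M)
    (g : Bundle.ContMDiffRiemannianMetric (𝓡∂ 3) ∞ (EuclideanSpace ℝ (Fin 3))
      (fun p : M => TangentSpace (𝓡∂ 3) p)) {x v : E3} (hx : x ∈ Ψ.dom) (hv : v ≠ 0) :
    0 < (Ψ.metric g).form x v v := by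
  rw [form_metric]
  refine g.pos _ _ fun h => hv ((Ψ.bijective_deriv x hx).1 ?_)
  exact h.trans (map_zero (mfderivWithin 𝓘(ℝ, E3) (𝓡∂ 3) Ψ.toFun Ψ.dom x)).symm

theorem posDef_metric (Ψ : BoundaryIdentification B M)
    (g : Bundle.ContMDiffRiemannianMetric (𝓡∂ 3) ∞ (EuclideanSpace ℝ (Fin 3))
      (fun p : M => TangentSpace (𝓡∂ 3) p)) {x : E3} (hx : x ∈ Ψ.dom) :
    (Ψ.metric g x).PosDef := by
  refine Matrix.PosDef.of_dotProduct_mulVec_pos ?_ fun v hv => ?_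
  · ext i j
    exact g.symm _ _ _
  · have h := Ψ.form_metric_pos g (v := WithLp.toLp 2 v) hx (by simpa using hv)
    simp only [MetricField.form] at h
    simp only [dotProduct, Matrix.mulVec, Pi.star_apply, star_trivial, Finset.mul_sum]
    refine h.trans_eq (Finset.sum_congr rfl fun a _ => Finset.sum_congr rfl fun b _ => ?_)
    ring

end BoundaryIdentification

/-! ### The flat mean curvature of a surface of revolution -/

theorem fderiv_eq_of_hasDerivAt {f : E3 → ℝ} {x v : E3} {a : ℝ} (hf : DifferentiableAt ℝ f x)
    (h : HasDerivAt (fun t : ℝ => f (x + t • v)) a 0) : fderiv ℝ f x v = a := by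
  rw [← hf.lineDeriv_eq_fderiv]
  exact h.deriv

/-- The derivative of a component of the radial unit field of the plane in its own direction. The
two such terms add up to the divergence `1 / ρ` of that field. -/
theorem hasDerivAt_div_sqrt {a b : ℝ} (h : 0 < a ^ 2 + b ^ 2) :
    HasDerivAt (fun t : ℝ => (a + t) / √((a + t) ^ 2 + b ^ 2))
      (b ^ 2 / √(a ^ 2 + b ^ 2) ^ 3) 0 := by
  have h1 : HasDerivAt (fun t : ℝ => a + t) 1 0 := (hasDerivAt_id _).const_add a
  have h2 := ((h1.fun_pow 2).add_const (b ^ 2)).sqrt (by simpa using h.ne')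
  have h3 := h1.fun_div h2 (by simpa using (Real.sqrt_pos.2 h).ne')
  refine h3.congr_deriv ?_
  have hs := Real.sqrt_pos.2 h
  have hsq := Real.sq_sqrt h.le
  simp only [add_zero]
  field_simp
  rw [hsq]
  ring

namespace RotProfile

variable {B : RotProfile}

theorem isOpen_offAxis : IsOpen {x : E3 | x 2 ∈ Ioo B.tm B.tp ∧ 0 < axisDist x} :=
  (isOpen_Ioo.preimage (by fun_prop : Continuous fun x : E3 => x 2)).inter
    (isOpen_Ioi.preimage continuous_axisDist)

theorem differentiableAt_outNormal {x : E3} (hx : x 2 ∈ Ioo B.tm B.tp) (hρ : 0 < axisDist x)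
    (i : Fin 3) : DifferentiableAt ℝ (fun y => B.outNormal y i) x :=
  ((B.contDiffOn_outNormal i).differentiableOn (by simp)).differentiableAt
    (isOpen_offAxis.mem_nhds ⟨hx, hρ⟩)

theorem fderiv_outNormal_zero {x : E3} (hx : x 2 ∈ Ioo B.tm B.tp) (hρ : 0 < axisDist x) :
    fderiv ℝ (fun y => B.outNormal y 0) x (stdVec 0) =
      (√(1 + deriv B.r (x 2) ^ 2))⁻¹ * (x 1 ^ 2 / axisDist x ^ 3) := by
  refine fderiv_eq_of_hasDerivAt (differentiableAt_outNormal hx hρ 0) ?_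
  have h := (hasDerivAt_div_sqrt (a := x 0) (b := x 1)
    (by rw [← axisDist_sq]; positivity)).const_mul (√(1 + deriv B.r (x 2) ^ 2))⁻¹
  simpa [outNormal, stdVec, axisDist] using h

theorem fderiv_outNormal_one {x : E3} (hx : x 2 ∈ Ioo B.tm B.tp) (hρ : 0 < axisDist x) :
    fderiv ℝ (fun y => B.outNormal y 1) x (stdVec 1) =
      (√(1 + deriv B.r (x 2) ^ 2))⁻¹ * (x 0 ^ 2 / axisDist x ^ 3) := by
  refine fderiv_eq_of_hasDerivAt (differentiableAt_outNormal hx hρ 1) ?_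
  have h := (hasDerivAt_div_sqrt (a := x 1) (b := x 0)
    (by rw [add_comm, ← axisDist_sq]; positivity)).const_mul (√(1 + deriv B.r (x 2) ^ 2))⁻¹
  simpa [outNormal, stdVec, axisDist, add_comm] using h

theorem fderiv_outNormal_two {x : E3} (hx : x 2 ∈ Ioo B.tm B.tp) (hρ : 0 < axisDist x) :
    fderiv ℝ (fun y => B.outNormal y 2) x (stdVec 2) =
      -(deriv (deriv B.r) (x 2) / √(1 + deriv B.r (x 2) ^ 2) ^ 3) := by
  refine fderiv_eq_of_hasDerivAt (differentiableAt_outNormal hx hρ 2) ?_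
  have h0 : HasDerivAt (deriv B.r) (deriv (deriv B.r) (x 2)) (x 2 + 0) := by
    rw [add_zero]
    exact ((contDiffOn_deriv_r.differentiableOn (by simp)).differentiableAt
      (isOpen_Ioo.mem_nhds hx)).hasDerivAt
  have h1 := h0.comp_const_add (x 2) 0
  have hpos : (0 : ℝ) < 1 + deriv B.r (x 2) ^ 2 := by positivity
  have hs := Real.sqrt_pos.2 hpos
  have hsq := Real.sq_sqrt hpos.le
  have h2 := ((h1.fun_pow 2).const_add 1).sqrt (by simpa using hpos.ne')
  have h3 := (h2.fun_inv (by simpa using hs.ne')).fun_mul h1.fun_neg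
  have h4 : HasDerivAt (fun t : ℝ => (√(1 + deriv B.r (x 2 + t) ^ 2))⁻¹ * -deriv B.r (x 2 + t))
      (-(deriv (deriv B.r) (x 2) / √(1 + deriv B.r (x 2) ^ 2) ^ 3)) 0 := by
    refine h3.congr_deriv ?_
    simp only [add_zero]
    field_simp
    rw [hsq]
    ring
  simpa [outNormal, stdVec] using h4

theorem unitNormal_flatMetric {x : E3} (hρ : 0 < axisDist x) (k : Fin 3) :
    unitNormal flatMetric B.outNormal k x = B.outNormal x k := by
  have h := B.norm_sq_outNormal hρ
  have h' : ∑ a, B.outNormal x a * B.outNormal x a = 1 := by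
    rw [Fin.sum_univ_three]; linear_combination h
  simp [unitNormal, flatMetric, Matrix.one_apply, h']

theorem christoffel_flatMetric (D : Set E3) (k i j : Fin 3) (x : E3) :
    christoffel flatMetric D k i j x = 0 := by
  simp [christoffel, partialWithin, flatMetric]

/-- The principal curvatures of the surface of revolution: `1 / (ρ √(1 + r'²))` along the parallels
and `- r'' / (1 + r'²)^(3/2)` along the meridians. -/
theorem meanCurvature_flatMetric {D : Set E3} {x : E3} (hD : UniqueDiffWithinAt ℝ D x)
    (hx : x 2 ∈ Ioo B.tm B.tp) (hρ : 0 < axisDist x) :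
    meanCurvature flatMetric D B.outNormal x =
      1 / (axisDist x * √(1 + deriv B.r (x 2) ^ 2))
        - deriv (deriv B.r) (x 2) / √(1 + deriv B.r (x 2) ^ 2) ^ 3 := by
  have h : ∀ i, covDeriv flatMetric D (unitNormal flatMetric B.outNormal) i i x =
      fderiv ℝ (fun y => B.outNormal y i) x (stdVec i) := fun i => by
    have he : unitNormal flatMetric B.outNormal i =ᶠ[𝓝 x] fun y => B.outNormal y i := by
      filter_upwards [B.isOpen_offAxis.mem_nhds ⟨hx, hρ⟩] with y hy
      exact unitNormal_flatMetric hy.2 i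
    simp only [covDeriv, christoffel_flatMetric, zero_mul, Finset.sum_const_zero, add_zero,
      partialWithin]
    rw [(he.filter_mono nhdsWithin_le_nhds).fderivWithin_eq he.eq_of_nhds,
      (differentiableAt_outNormal hx hρ i).fderivWithin hD]
  have hs : 0 < √(1 + deriv B.r (x 2) ^ 2) := Real.sqrt_pos.2 (by positivity)
  simp only [meanCurvature, h, Fin.sum_univ_three, fderiv_outNormal_zero hx hρ,
    fderiv_outNormal_one hx hρ, fderiv_outNormal_two hx hρ]
  have := axisDist_sq x
  field_simp
  linear_combination (-1 : ℝ) * √(1 + deriv B.r (x 2) ^ 2) ^ 2 * this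

end RotProfile

/-! ### The polar angle along a separating curve -/

/-- A nowhere vanishing `C¹` plane curve has a `C¹` polar angle. -/
theorem exists_polar_angle {u v : ℝ → ℝ} (hu : ContDiff ℝ 1 u) (hv : ContDiff ℝ 1 v)
    (h0 : ∀ t, 0 < u t ^ 2 + v t ^ 2) :
    ∃ θ : ℝ → ℝ, (∀ t, HasDerivAt θ ((u t * deriv v t - v t * deriv u t) / (u t ^ 2 + v t ^ 2)) t) ∧
      ∀ t, u t = √(u t ^ 2 + v t ^ 2) * Real.cos (θ t) ∧
        v t = √(u t ^ 2 + v t ^ 2) * Real.sin (θ t) := by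
  set q : ℝ → ℝ := fun t => (u t * deriv v t - v t * deriv u t) / (u t ^ 2 + v t ^ 2) with hq
  have hqc : Continuous q :=
    ((hu.continuous.mul (hv.continuous_deriv le_rfl)).sub
      (hv.continuous.mul (hu.continuous_deriv le_rfl))).div
      ((hu.continuous.pow 2).add (hv.continuous.pow 2)) fun t => (h0 t).ne'
  -- The argument of the starting point.
  obtain ⟨θ₀, hc0, hs0⟩ : ∃ θ₀ : ℝ, u 0 = √(u 0 ^ 2 + v 0 ^ 2) * Real.cos θ₀ ∧
      v 0 = √(u 0 ^ 2 + v 0 ^ 2) * Real.sin θ₀ := by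
    refine ⟨Complex.arg ⟨u 0, v 0⟩, ?_⟩
    have hn : ‖(⟨u 0, v 0⟩ : ℂ)‖ = √(u 0 ^ 2 + v 0 ^ 2) := by
      rw [Complex.norm_def, Complex.normSq_mk]; ring_nf
    rw [← hn]
    exact ⟨(Complex.norm_mul_cos_arg ⟨u 0, v 0⟩).symm, (Complex.norm_mul_sin_arg ⟨u 0, v 0⟩).symm⟩
  set θ : ℝ → ℝ := fun t => θ₀ + ∫ s in (0 : ℝ)..t, q s with hθ
  have hθd : ∀ t, HasDerivAt θ (q t) t := fun t =>
    (intervalIntegral.integral_hasDerivAt_right (hqc.intervalIntegrable _ _)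
      (hqc.stronglyMeasurableAtFilter _ _) hqc.continuousAt).const_add θ₀
  have hud : ∀ t, HasDerivAt u (deriv u t) t := fun t =>
    (hu.differentiable (by simp) t).hasDerivAt
  have hvd : ∀ t, HasDerivAt v (deriv v t) t := fun t =>
    (hv.differentiable (by simp) t).hasDerivAt
  set R : ℝ → ℝ := fun t => √(u t ^ 2 + v t ^ 2) with hR
  change u 0 = R 0 * _ at hc0
  change v 0 = R 0 * _ at hs0
  have hRpos : ∀ t, 0 < R t := fun t => Real.sqrt_pos.2 (h0 t)
  have hRsq : ∀ t, R t ^ 2 = u t ^ 2 + v t ^ 2 := fun t => Real.sq_sqrt (h0 t).le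
  have hRd : ∀ t, HasDerivAt R ((u t * deriv u t + v t * deriv v t) / R t) t := fun t => by
    have := (((hud t).fun_pow 2).fun_add ((hvd t).fun_pow 2)).sqrt (h0 t).ne'
    refine this.congr_deriv ?_
    have := hRpos t
    simp only [hR] at this ⊢
    field_simp
    ring
  have hqR : ∀ t, q t = (u t * deriv v t - v t * deriv u t) / R t ^ 2 := fun t => by
    rw [hRsq]
  -- The unit vector `(u, v) / R`, rotated back by `θ`, is constant.
  have hA : ∀ t, HasDerivAt
      (fun t => (u t * Real.cos (θ t) + v t * Real.sin (θ t)) / R t) 0 t := fun t => by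
    have := ((((hud t).fun_mul (hθd t).cos).fun_add
      ((hvd t).fun_mul (hθd t).sin)).fun_div (hRd t) (hRpos t).ne')
    refine this.congr_deriv ?_
    rw [hqR]
    have := (hRpos t).ne'
    have h2 := hRsq t
    field_simp
    rw [h2]
    ring
  have hB : ∀ t, HasDerivAt
      (fun t => (v t * Real.cos (θ t) - u t * Real.sin (θ t)) / R t) 0 t := fun t => by
    have := ((((hvd t).fun_mul (hθd t).cos).fun_sub
      ((hud t).fun_mul (hθd t).sin)).fun_div (hRd t) (hRpos t).ne')
    refine this.congr_deriv ?_
    rw [hqR]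
    have := (hRpos t).ne'
    have h2 := hRsq t
    field_simp
    rw [h2]
    ring
  have hθ0 : θ 0 = θ₀ := by simp [hθ]
  have hA1 : ∀ t, (u t * Real.cos (θ t) + v t * Real.sin (θ t)) / R t = 1 := fun t => by
    have := is_const_of_deriv_eq_zero (fun t => (hA t).differentiableAt)
      (fun t => (hA t).deriv) t 0
    rw [this, hθ0, div_eq_one_iff_eq (hRpos 0).ne']
    linear_combination Real.cos θ₀ * hc0 + Real.sin θ₀ * hs0 + R 0 * Real.cos_sq_add_sin_sq θ₀
  have hB1 : ∀ t, (v t * Real.cos (θ t) - u t * Real.sin (θ t)) / R t = 0 := fun t => by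
    have := is_const_of_deriv_eq_zero (fun t => (hB t).differentiableAt)
      (fun t => (hB t).deriv) t 0
    rw [this, hθ0, div_eq_zero_iff]
    left
    linear_combination Real.cos θ₀ * hs0 - Real.sin θ₀ * hc0
  refine ⟨θ, hθd, fun t => ?_⟩
  have h1 := (div_eq_one_iff_eq (hRpos t).ne').1 (hA1 t)
  have h2 := (div_eq_zero_iff.1 (hB1 t)).resolve_right (hRpos t).ne'
  have h3 := Real.cos_sq_add_sin_sq (θ t)
  constructor
  · change u t = R t * _
    linear_combination Real.cos (θ t) * h1 - Real.sin (θ t) * h2 - u t * h3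
  · change v t = R t * _
    linear_combination Real.sin (θ t) * h1 + Real.cos (θ t) * h2 - v t * h3

/-- If a continuous function takes every value modulo `2π`, its variation is at least `2π`. -/
theorem two_pi_le_integral_abs_deriv {θ q : ℝ → ℝ} {T : ℝ} (hT : 0 ≤ T)
    (hθ : ∀ t, HasDerivAt θ (q t) t) (hq : Continuous q)
    (hsurj : ∀ φ : ℝ, ∃ t ∈ Icc 0 T, ∃ k : ℤ, θ t = φ + k * (2 * Real.pi)) :
    2 * Real.pi ≤ ∫ t in (0 : ℝ)..T, |q t| := by
  have hc : Continuous θ := continuous_iff_continuousAt.2 fun t => (hθ t).continuousAt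
  have hne : (Icc (0 : ℝ) T).Nonempty := nonempty_Icc.2 hT
  obtain ⟨a, ha, hamin⟩ := isCompact_Icc.exists_isMinOn hne hc.continuousOn
  obtain ⟨b, hb, hbmax⟩ := isCompact_Icc.exists_isMaxOn hne hc.continuousOn
  have hint : ∀ s t, IntervalIntegrable q MeasureTheory.volume s t := fun s t =>
    hq.intervalIntegrable s t
  have hosc : θ b - θ a ≤ ∫ t in (0 : ℝ)..T, |q t| := by
    rw [← intervalIntegral.integral_eq_sub_of_hasDerivAt (fun t _ => hθ t) (hint a b)]
    have h1 : |∫ t in a..b, q t| ≤ |(∫ t in a..b, |q t|)| := by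
      simpa only [Real.norm_eq_abs] using
        intervalIntegral.norm_integral_le_abs_integral_norm (f := q) (a := a) (b := b)
          (μ := MeasureTheory.volume)
    refine (le_abs_self _).trans (h1.trans ?_)
    refine (intervalIntegral.abs_integral_mono_interval (c := 0) (d := T) ?_
      (MeasureTheory.ae_of_all _ fun t => abs_nonneg _)
      (hq.abs.intervalIntegrable _ _)).trans ?_
    · rw [uIoc_of_le hT]
      exact Ioc_subset_Ioc (le_min ha.1 hb.1) (max_le ha.2 hb.2)
    · rw [abs_of_nonneg (intervalIntegral.integral_nonneg hT fun t _ => abs_nonneg _)]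
  refine le_trans ?_ hosc
  by_contra! hlt
  -- The midpoint of the gap between `θ b` and `θ a + 2π` is missed modulo `2π`.
  obtain ⟨t, ht, k, hk⟩ := hsurj ((θ b + θ a + 2 * Real.pi) / 2)
  have h1 := hamin ht
  have h2 := hbmax ht
  simp only [mem_ofPred_eq] at h1 h2
  have hpi := Real.pi_pos
  rcases le_or_gt 0 k with hk0 | hk0
  · have : (0 : ℝ) ≤ k := by exact_mod_cast hk0
    nlinarith
  · have : (k : ℝ) ≤ -1 := by exact_mod_cast Int.le_sub_one_of_lt hk0
    nlinarith

namespace RotProfile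

variable {B : RotProfile}

/-- A separating curve meets every meridian, since a meridian joins the two polar sets. -/
theorem _root_.IsSeparatingCurve.exists_mem_meridian {c : ℝ → E3} {T : ℝ}
    (hc : IsSeparatingCurve B c T) (φ : ℝ) :
    ∃ t ∈ Icc 0 T, ∃ s ∈ Icc B.tm B.tp, c t = B.meridian φ s := by
  by_contra! hno
  have hl : B.tm ∈ Icc B.tm B.tp := left_mem_Icc.2 B.tm_lt_tp.le
  have hr : B.tp ∈ Icc B.tm B.tp := right_mem_Icc.2 B.tm_lt_tp.le
  have hsub : B.meridian φ '' Icc B.tm B.tp ⊆ B.bdry \ range c := by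
    rintro _ ⟨s, hs, rfl⟩
    refine ⟨meridian_mem_bdry φ hs, ?_⟩
    rintro ⟨t, ht⟩
    obtain ⟨t', ht', h⟩ := hc.periodic.exists_mem_Ico₀ hc.period_pos t
    exact hno t' (Ico_subset_Icc_self ht') s hs (h ▸ ht)
  have hconn : IsPreconnected (B.meridian φ '' Icc B.tm B.tp) :=
    isPreconnected_Icc.image _ (continuousOn_meridian φ)
  exact hc.separates _ ⟨meridian_mem_bdry φ hr, by simp [meridian]⟩ _
    ⟨meridian_mem_bdry φ hl, by simp [meridian]⟩
    (hconn.subset_connectedComponentIn (mem_image_of_mem _ hr) hsub (mem_image_of_mem _ hl))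

/-- The total variation of the polar angle along a separating curve is at least `2π`. -/
theorem _root_.IsSeparatingCurve.two_pi_le_integral {c : ℝ → E3} {T : ℝ}
    (hc : IsSeparatingCurve B c T) :
    2 * Real.pi ≤ ∫ t in (0 : ℝ)..T,
      |(c t 0 * deriv c t 1 - c t 1 * deriv c t 0) / axisDist (c t) ^ 2| := by
  have hpos : ∀ t, 0 < axisDist (c t) := fun t => axisDist_pos_of_mem_lateral (hc.mem_lateral t)
  have hi : ∀ i, ContDiff ℝ 1 (fun t => c t i) := fun i => by
    have := hc.contDiff
    fun_prop
  have hd : ∀ i t, deriv (fun t => c t i) t = deriv c t i := fun i t => by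
    have h := (hc.contDiff.differentiable (by simp) t).hasDerivAt
    exact ((EuclideanSpace.proj i : E3 →L[ℝ] ℝ).hasFDerivAt.comp_hasDerivAt t h).deriv
  obtain ⟨θ, hθ, hpol⟩ := exists_polar_angle (hi 0) (hi 1) fun t => by
    rw [← axisDist_sq]; have := hpos t; positivity
  simp only [hd, ← axisDist_sq, Real.sqrt_sq (axisDist_nonneg _)] at hθ hpol
  refine two_pi_le_integral_abs_deriv hc.period_pos.le hθ ?_ fun φ => ?_
  · have h1 := hc.contDiff.continuous
    have h2 := hc.contDiff.continuous_deriv le_rfl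
    have h3 := continuous_axisDist.comp h1
    exact Continuous.div (by fun_prop) (h3.pow 2) fun t => (pow_pos (hpos t) 2).ne'
  · obtain ⟨t, ht, s, hs, hts⟩ := hc.exists_mem_meridian φ
    have hρ : axisDist (c t) = B.r s := by rw [hts, meridian, axisDist_polar (r_nonneg hs)]
    have hp := hpos t
    obtain ⟨hcos, hsin⟩ := hpol t
    have e0 : c t 0 = axisDist (c t) * Real.cos φ := by rw [hρ, hts]; simp [meridian]
    have e1 : c t 1 = axisDist (c t) * Real.sin φ := by rw [hρ, hts]; simp [meridian]
    have hcc := mul_left_cancel₀ hp.ne' (hcos.symm.trans e0)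
    have hss := mul_left_cancel₀ hp.ne' (hsin.symm.trans e1)
    have := Real.Angle.cos_sin_inj hcc hss
    obtain ⟨k, hk⟩ := Real.Angle.angle_eq_iff_two_pi_dvd_sub.1 this
    exact ⟨t, ht, k, by linear_combination hk⟩

end RotProfile

/-! ### The pointwise estimate and the integral inequality -/

theorem MetricField.form_flatMetric (x v : E3) :
    flatMetric.form x v v = v 0 ^ 2 + v 1 ^ 2 + v 2 ^ 2 := by
  simp [MetricField.form, flatMetric, Matrix.one_apply, Fin.sum_univ_three]
  ring

namespace RotProfile

variable {B : RotProfile}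

theorem isTangent_deriv {c : ℝ → E3} (hc : Differentiable ℝ c) (hmem : ∀ t, c t ∈ B.lateral)
    (t : ℝ) : B.IsTangent (c t) (deriv c t) := by
  have hd : ∀ i, HasDerivAt (fun t => c t i) (deriv c t i) t := fun i =>
    (EuclideanSpace.proj i : E3 →L[ℝ] ℝ).hasFDerivAt.comp_hasDerivAt t (hc t).hasDerivAt
  have hr : HasDerivAt B.r (deriv B.r (c t 2)) (c t 2) :=
    ((B.r_smooth.differentiableOn (by simp)).differentiableAt
      (isOpen_Ioo.mem_nhds (hmem t).2)).hasDerivAt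
  have h1 := ((hd 0).fun_pow 2).fun_add ((hd 1).fun_pow 2)
  have h2 := (hr.comp t (hd 2)).fun_pow 2
  have he : (fun t => c t 0 ^ 2 + c t 1 ^ 2) = fun t => (B.r ∘ fun t => c t 2) t ^ 2 := by
    ext t
    rw [← axisDist_sq, axisDist_of_mem_lateral (hmem t)]; rfl
  rw [he] at h1
  have h := h1.unique h2
  rw [isTangent_iff, div_eq_iff (axisDist_pos_of_mem_lateral (hmem t)).ne',
    axisDist_of_mem_lateral (hmem t)]
  simp only [Function.comp_apply] at h
  push_cast at h
  linear_combination h / 2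

/-- The height of a tangent vector of length at most `1` is at most that of the unit vector along
the meridian, which is `1 / √(1 + r'²)`. -/
theorem IsTangent.abs_height_le {x v : E3} (hx : 0 < axisDist x) (hv : B.IsTangent x v)
    (h1 : v 0 ^ 2 + v 1 ^ 2 + v 2 ^ 2 ≤ 1) : |√(1 + deriv B.r (x 2) ^ 2) * v 2| ≤ 1 := by
  rw [isTangent_iff, div_eq_iff hx.ne'] at hv
  rw [← sq_le_one_iff_abs_le_one, mul_pow, Real.sq_sqrt (by positivity)]
  have hsq := axisDist_sq x
  have h2 : deriv B.r (x 2) ^ 2 * v 2 ^ 2 ≤ v 0 ^ 2 + v 1 ^ 2 := by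
    refine le_of_mul_le_mul_left ?_ (pow_pos hx 2)
    have e : axisDist x ^ 2 * (deriv B.r (x 2) ^ 2 * v 2 ^ 2) = (x 0 * v 0 + x 1 * v 1) ^ 2 := by
      rw [hv]; ring
    rw [e, hsq]
    nlinarith [sq_nonneg (x 0 * v 1 - x 1 * v 0)]
  linarith

/-- The angular speed of a tangent vector is at most its horizontal length over the radius. -/
theorem abs_angular_le {x v : E3} (hx : 0 < axisDist x) :
    |(x 0 * v 1 - x 1 * v 0) / axisDist x ^ 2| ≤
      √(v 0 ^ 2 + v 1 ^ 2 + v 2 ^ 2) / axisDist x := by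
  have hsq := axisDist_sq x
  rw [abs_div, abs_of_pos (pow_pos hx 2), div_le_div_iff₀ (pow_pos hx 2) hx]
  have h : |x 0 * v 1 - x 1 * v 0| ≤ √(v 0 ^ 2 + v 1 ^ 2 + v 2 ^ 2) * axisDist x := by
    refine abs_le_of_sq_le_sq ?_ (by positivity)
    rw [mul_pow, Real.sq_sqrt (by positivity), hsq]
    nlinarith [sq_nonneg (x 0 * v 0 + x 1 * v 1), mul_nonneg (sq_nonneg (v 2))
      (add_nonneg (sq_nonneg (x 0)) (sq_nonneg (x 1)))]
  nlinarith

/-- The pointwise estimate: the meridian curvature term `- r'' / (1 + r'²) * (1 + √(1 + r'²) η³)`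
is nonnegative, and what remains is at least the angular speed of the curve. -/
theorem abs_angular_le_integrand (hB : B.WeaklyConvex) {G : MetricField} {x v e : E3} {H : ℝ}
    (hx : x ∈ B.lateral) (hσ : ∀ v, B.IsTangent x v → flatMetric.form x v v ≤ G.form x v v)
    (hH : 1 / (axisDist x * √(1 + deriv B.r (x 2) ^ 2))
      - deriv (deriv B.r) (x 2) / √(1 + deriv B.r (x 2) ^ 2) ^ 3 ≤ H)
    (hv : B.IsTangent x v) (he : B.IsTangent x e) (he1 : G.form x e e = 1) :
    |(x 0 * v 1 - x 1 * v 0) / axisDist x ^ 2| ≤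
      (H / Real.sin (B.angle x) - 1 / Real.sin (B.angle x) * fderiv ℝ B.angle x e)
        * G.len x v := by
  have hρ := axisDist_pos_of_mem_lateral hx
  have hlen : √(v 0 ^ 2 + v 1 ^ 2 + v 2 ^ 2) ≤ G.len x v := by
    rw [← MetricField.form_flatMetric x]
    exact Real.sqrt_le_sqrt (hσ v hv)
  have he2 := (abs_le.1 (he.abs_height_le hρ
    (by rw [← MetricField.form_flatMetric x, ← he1]; exact hσ e he))).1
  have hq := deriv_deriv_r_nonpos hB hx.2
  rw [sin_angle, fderiv_angle hx.2]
  have hpos : (0 : ℝ) < 1 + deriv B.r (x 2) ^ 2 := by positivity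
  have hw := Real.sqrt_pos.2 hpos
  have hwsq := Real.sq_sqrt hpos.le
  set w := √(1 + deriv B.r (x 2) ^ 2)
  set q := deriv (deriv B.r) (x 2)
  rw [← hwsq, one_div_one_div, div_div_eq_mul_div, div_one]
  refine (abs_angular_le hρ).trans ((div_le_div_of_nonneg_right hlen hρ.le).trans ?_)
  rw [div_eq_mul_one_div, mul_comm]
  refine mul_le_mul_of_nonneg_right ?_ (Real.sqrt_nonneg _)
  have h1 := mul_le_mul_of_nonneg_right hH hw.le
  have h2 : (1 / (axisDist x * w) - q / w ^ 3) * w - w * (q / w ^ 2 * e 2) =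
      1 / axisDist x + -q / w ^ 2 * (1 + w * e 2) := by
    field_simp
    ring
  have h3 : 0 ≤ -q / w ^ 2 * (1 + w * e 2) :=
    mul_nonneg (div_nonneg (by linarith) (by positivity)) (by linarith)
  linarith

end RotProfile

theorem BoundaryIdentification.lateral_subset_dom {B : RotProfile} {M : Type*} [TopologicalSpace M]
    [ChartedSpace (EuclideanHalfSpace 3) M] (Ψ : BoundaryIdentification B M) :
    B.lateral ⊆ Ψ.dom :=
  fun _ hx => ⟨RotProfile.body_of_mem_lateral hx, Ψ.lateral_subset hx⟩

/-- The integrand is continuous along the curve; in particular its integral is meaningful. -/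
theorem continuous_integrand {B : RotProfile} (hB : B.WeaklyConvex)
    {M : Type*} [TopologicalSpace M] [ChartedSpace (EuclideanHalfSpace 3) M]
    [IsManifold (𝓡∂ 3) ∞ M]
    (g : Bundle.ContMDiffRiemannianMetric (𝓡∂ 3) ∞ (EuclideanSpace ℝ (Fin 3))
      (fun p : M => TangentSpace (𝓡∂ 3) p))
    (Ψ : BoundaryIdentification B M) {c η : ℝ → E3} (hc : ContDiff ℝ 1 c)
    (hmem : ∀ t, c t ∈ B.lateral) (hη : Continuous η) :
    Continuous fun t =>
      (meanCurvature (Ψ.metric g) Ψ.dom B.outNormal (c t) / Real.sin (B.angle (c t))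
        - 1 / Real.sin (B.angle (c t)) * fderiv ℝ B.angle (c t) (η t))
        * (Ψ.metric g).len (c t) (deriv c t) := by
  have hcc := hc.continuous
  have hc' := hc.continuous_deriv le_rfl
  have hρ : ∀ t, 0 < axisDist (c t) := fun t => RotProfile.axisDist_pos_of_mem_lateral (hmem t)
  have hdom : ∀ t, c t ∈ Ψ.dom := fun t => Ψ.lateral_subset_dom (hmem t)
  have hH : Continuous fun t => meanCurvature (Ψ.metric g) Ψ.dom B.outNormal (c t) := by
    refine (MetricField.continuousOn_meanCurvature (Ψ.uniqueDiffOn_dom hB) B.isOpen_offAxis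
      (Ψ.contDiffOn_metric hB g) (fun x hx => Ψ.posDef_metric g hx)
      (fun i => (B.contDiffOn_outNormal i).mono inter_subset_right)
      (fun x hx h => ?_)).comp_continuous hcc fun t => ⟨hdom t, (hmem t).2, hρ t⟩
    have := B.norm_sq_outNormal hx.2.2
    simp [h] at this
  have hp : Continuous fun t => deriv B.r (c t 2) :=
    RotProfile.contDiffOn_deriv_r.continuousOn.comp_continuous (by fun_prop) fun t => (hmem t).2
  have hq : Continuous fun t => deriv (deriv B.r) (c t 2) :=
    (RotProfile.contDiffOn_deriv_r.continuousOn_deriv_of_isOpen isOpen_Ioo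
      (by simp)).comp_continuous (by fun_prop) fun t => (hmem t).2
  have hG : Continuous fun t => (Ψ.metric g).len (c t) (deriv c t) :=
    (continuous_finsetSum _ fun i _ => continuous_finsetSum _ fun j _ =>
      (((Ψ.contDiffOn_metric hB g i j).continuousOn.comp_continuous hcc hdom).mul
        (by fun_prop)).mul (by fun_prop)).sqrt
  have hs : Continuous fun t => √(1 + deriv B.r (c t 2) ^ 2) := by fun_prop
  have hd : Continuous fun t =>
      deriv (deriv B.r) (c t 2) / (1 + deriv B.r (c t 2) ^ 2) * η t 2 :=
    (hq.div (by fun_prop) fun t => by positivity).mul (by fun_prop)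
  simp only [RotProfile.sin_angle, RotProfile.fderiv_angle (hmem _).2, one_mul,
    div_div_eq_mul_div, div_one]
  exact ((hH.mul hs).sub (hs.mul hd)).mul hG

theorem lemma3p1 (B : RotProfile) (hB : B.WeaklyConvex)
    {M : Type*} [TopologicalSpace M] [ChartedSpace (EuclideanHalfSpace 3) M]
    [IsManifold (𝓡∂ 3) ∞ M]
    (g : Bundle.ContMDiffRiemannianMetric (𝓡∂ 3) ∞ (EuclideanSpace ℝ (Fin 3))
      (fun p : M => TangentSpace (𝓡∂ 3) p))
    (Ψ : BoundaryIdentification B M)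
    (hσ : ∀ x ∈ B.lateral, ∀ v : E3, B.IsTangent x v →
      flatMetric.form x v v ≤ (Ψ.metric g).form x v v)
    (hH : ∀ x ∈ B.lateral,
      meanCurvature flatMetric Ψ.dom B.outNormal x ≤
        meanCurvature (Ψ.metric g) Ψ.dom B.outNormal x)
    (c : ℝ → E3) (T : ℝ) (hc : IsSeparatingCurve B c T)
    (η : ℝ → E3) (hη : IsUnitConormal B (Ψ.metric g) c η) :
    2 * Real.pi ≤ ∫ t in (0 : ℝ)..T,
      (meanCurvature (Ψ.metric g) Ψ.dom B.outNormal (c t) / Real.sin (B.angle (c t))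
        - 1 / Real.sin (B.angle (c t)) * fderiv ℝ B.angle (c t) (η t))
        * (Ψ.metric g).len (c t) (deriv c t) := by

  refine hc.two_pi_le_integral.trans (intervalIntegral.integral_mono_on hc.period_pos.le ?_ ?_ ?_)
  · have h1 := hc.contDiff.continuous
    have h2 := hc.contDiff.continuous_deriv le_rfl
    have h3 := continuous_axisDist.comp h1
    exact (Continuous.div (by fun_prop) (h3.pow 2) fun t => (pow_pos
      (RotProfile.axisDist_pos_of_mem_lateral (hc.mem_lateral t)) 2).ne').abs.intervalIntegrable _ _
  · exact (continuous_integrand hB g Ψ hc.contDiff hc.mem_lateral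
      hη.continuous).intervalIntegrable _ _
  · intro t _
    have hx := hc.mem_lateral t
    refine RotProfile.abs_angular_le_integrand hB hx (hσ _ hx) ?_
      (RotProfile.isTangent_deriv (hc.contDiff.differentiable (by simp)) hc.mem_lateral t)
      (hη.tangent t) (hη.unit t)
    rw [← RotProfile.meanCurvature_flatMetric
      (Ψ.uniqueDiffOn_dom hB _ (Ψ.lateral_subset_dom hx)) hx.2
      (RotProfile.axisDist_pos_of_mem_lateral hx)]
    exact hH _ hx
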